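/- Let $Q_4$ be the $4$-cube with vertex set $\{1,\dots,16\}$, where the vertices $1,\dots,16$ stand for the subsets $\emptyset$, $a$, $b$, $c$, $d$, $ab$, $ac$, $bc$, $ad$, $bd$, $cd$, $abc$, $abd$, $acd$, $bcd$, $abcd$ of $\{a,b,c,d\}$ in this order, and two vertices are adjacent if the subsets differ in exactly one element. Let $\tilde Q_4$ be the switched $4$-cube, obtained from $Q_4$ by Godsil–McKay switching with respect to the partition $C_1=\{1\}$, $C_2=\{6,\dots,11\}$, $C_3=\{12,\dots,15\}$, $C_4=\{16\}$, $D=\{2,3,4,5\}$; that is, whenever $v\in D$ is adjacent to exactly half of the vertices of some $C_i$, the edges from $v$ to these are deleted and $v$ is joined instead to the other half of $C_i$. Let $A_{4,1}$ and $A_{4,2}$ be the adjacency matrices of $Q_4$ and $\tilde Q_4$, and let $$A_{5,3}=\begin{bmatrix}A_{4,1}&I\\ I&A_{4,2}\end{bmatrix},$$ with $I$ the $16\times16$ identity matrix, be the adjacency matrix of the partially switched $5$-cube, with vertex set $\{1,\dots,32\}$. A vertex $j$ has perfect state transfer (PST) if there are a vertex $k\ne j$ and a time $t\in\mathbb R$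 with $\left|\left(e^{itA_{5,3}}\right)_{jk}\right|^2=1$. Then the set of vertices with PST is exactly $\{1,16,17,32\}$; that is, exactly $1/8$ of the vertices have PST. -/

import Mathlib

/-- The `n`-cube graph: two bit strings are adjacent when they differ in exactly one place. -/
def hypercube (n : ℕ) : SimpleGraph (Fin n → Bool) where
  Adj x y := hammingDist x y = 1
  symm := ⟨fun x y h => by rw [hammingDist_comm]; exact h⟩
  loopless := ⟨fun x h => by simp at h⟩

instance (n : ℕ) : DecidableRel (hypercube n).Adj :=
  fun x y => inferInstanceAs (Decidable (hammingDist x y = 1))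

/-- The labelling of the vertices of the 4-cube: vertex number `j + 1` is the bit string of the
`j`-th number in this list (bit strings in order of weight, then of the number they encode). -/
def cubeLabel (j : Fin 16) : Fin 4 → Bool :=
  fun b => ((![0, 1, 2, 4, 8, 3, 5, 6, 9, 10, 12, 7, 11, 13, 14, 15] : Fin 16 → ℕ) j).testBit b

theorem cubeLabel_bijective : Function.Bijective cubeLabel := by
  decide +kernel

/-- The 4-cube on the vertices `1, …, 16`; the vertex number `j + 1` is `j : Fin 16`. -/
def Q4 : SimpleGraph (Fin 16) := (hypercube 4).comap cubeLabel

instance : DecidableRel Q4.Adj :=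
  fun i j => inferInstanceAs (Decidable ((hypercube 4).Adj (cubeLabel i) (cubeLabel j)))

/-- In Godsil-McKay switching with cells `C i` and `D`, the pair `v, w` is changed if `v` lies in
`D`, `w` lies in some `C i`, and `v` is adjacent to exactly half of the vertices of `C i`. -/
def GMFlip {V ι : Type*} (G : SimpleGraph V) [DecidableRel G.Adj]
    (C : ι → Finset V) (D : Finset V) (v w : V) : Prop :=
  v ∈ D ∧ ∃ i, w ∈ C i ∧ 2 * ((C i).filter (fun x => G.Adj v x)).card = (C i).card

instance {V ι : Type*} [DecidableEq V] [Fintype ι] (G : SimpleGraph V) [DecidableRel G.Adj]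
    (C : ι → Finset V) (D : Finset V) : DecidableRel (GMFlip G C D) :=
  fun v w => inferInstanceAs (Decidable
    (v ∈ D ∧ ∃ i, w ∈ C i ∧ 2 * ((C i).filter (fun x => G.Adj v x)).card = (C i).card))

/-- Godsil-McKay switching of `G` with respect to the partition with cells `C i` and `D`: edges
and non-edges are exchanged for the pairs that are changed, all other pairs are kept. -/
def gmSwitch {V ι : Type*} (G : SimpleGraph V) [DecidableRel G.Adj]
    (C : ι → Finset V) (D : Finset V) : SimpleGraph V where
  Adj v w := v ≠ w ∧ Xor (G.Adj v w) (GMFlip G C D v w ∨ GMFlip G C D w v)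
  symm := ⟨fun v w h => ⟨h.1.symm, by rw [G.adj_comm, or_comm]; exact h.2⟩⟩
  loopless := ⟨fun v h => h.1 rfl⟩

instance {V ι : Type*} [DecidableEq V] [Fintype ι] (G : SimpleGraph V) [DecidableRel G.Adj]
    (C : ι → Finset V) (D : Finset V) : DecidableRel (gmSwitch G C D).Adj :=
  fun v w => inferInstanceAs (Decidable
    (v ≠ w ∧ ((G.Adj v w ∧ ¬ (GMFlip G C D v w ∨ GMFlip G C D w v)) ∨
      ((GMFlip G C D v w ∨ GMFlip G C D w v) ∧ ¬ G.Adj v w))))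

/-- The cells `{1}`, `{6, …, 11}`, `{12, …, 15}`, `{16}` (vertex numbers). -/
def cellsC : Fin 4 → Finset (Fin 16) :=
  ![{0}, {5, 6, 7, 8, 9, 10}, {11, 12, 13, 14}, {15}]

/-- The cell `{2, 3, 4, 5}` (vertex numbers). -/
def cellD : Finset (Fin 16) := {1, 2, 3, 4}

/-- The switched 4-cube. -/
def switchedQ4 : SimpleGraph (Fin 16) := gmSwitch Q4 cellsC cellD

instance : DecidableRel switchedQ4.Adj :=
  inferInstanceAs (DecidableRel (gmSwitch Q4 cellsC cellD).Adj)

/-- The adjacency matrix of the 4-cube. -/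
def A41 : Matrix (Fin 16) (Fin 16) ℂ := Q4.adjMatrix ℂ

/-- The adjacency matrix of the switched 4-cube. -/
def A42 : Matrix (Fin 16) (Fin 16) ℂ := switchedQ4.adjMatrix ℂ

/-- The adjacency matrix of the partially switched 5-cube. Vertex `j` of the first block and
vertex `j` of the second block become `j` and `16 + j`; vertex number `v + 1` is `v : Fin 32`. -/
def A53 : Matrix (Fin 32) (Fin 32) ℂ :=
  Matrix.reindex finSumFinEquiv finSumFinEquiv (Matrix.fromBlocks A41 1 1 A42)

/-- The fidelity of state transfer `|⟨j| exp(i t H) |k⟩|²`. -/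
noncomputable def fidelity {V : Type*} [Fintype V] [DecidableEq V] (H : Matrix V V ℂ)
    (j k : V) (t : ℝ) : ℝ :=
  ‖NormedSpace.exp ((Complex.I * (t : ℂ)) • H) j k‖ ^ 2

/-- Perfect state transfer between two different vertices. -/
def HasPST {V : Type*} [Fintype V] [DecidableEq V] (H : Matrix V V ℂ) (j k : V) : Prop :=
  j ≠ k ∧ ∃ t : ℝ, fidelity H j k t = 1

/-- The set of vertices that have perfect state transfer with some other vertex. -/
def pstVertices {V : Type*} [Fintype V] [DecidableEq V] (H : Matrix V V ℂ) : Set V :=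
  {j | ∃ k, HasPST H j k}

/-! PST from `j` to `k` at time `t` forces `exp (2itμ)` to be the same for every eigenvalue `μ`
whose eigenspace does not vanish at `j`. The eigenvalues `±5` qualify at every vertex, so `t` is a
rational multiple of `π`, and a nonzero irrational eigenvalue seen at `j` is then impossible. Such
an eigenvalue comes from additive set functions of total weight zero: restricted to single levels
they span an invariant space, on which the matrix acts by `weightAction`. A suitable eigenvector is
nonzero off the four corners (`not_hasPST_A53`). Switching preserves how many neighbours a vertex
has on each level. Around `0` and around `15`, the matrix therefore acts on radial functions as for
the 5-cube, and the antipodal transfer at time `π / 2` survives (`hasPST_A53_of_cornerDist`). -/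

open Matrix NormedSpace

/-! ### Eigenvalue support and perfect state transfer -/

section General

variable {V : Type*} [Fintype V] [DecidableEq V]

theorem exp_mulVec_of_eigenvector {H : Matrix V V ℂ} {w : V → ℂ} {μ : ℂ}
    (h : H *ᵥ w = μ • w) : exp H *ᵥ w = Complex.exp μ • w := by
  have hpow : ∀ n : ℕ, (H ^ n) *ᵥ w = μ ^ n • w := by
    intro n
    induction n with
    | zero => simp
    | succ n ih => rw [pow_succ, ← mulVec_mulVec, h, mulVec_smul, ih, smul_smul, pow_succ']
  let : NormedRing (Matrix V V ℂ) := Matrix.linftyOpNormedRing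
  let : NormedAlgebra ℂ (Matrix V V ℂ) := Matrix.linftyOpNormedAlgebra
  have hH : HasSum (fun n : ℕ => (n.factorial⁻¹ : ℂ) • H ^ n) (exp H) :=
    exp_series_hasSum_exp' H
  have hμ : HasSum (fun n : ℕ => (n.factorial⁻¹ : ℂ) • μ ^ n) (Complex.exp μ) := by
    rw [Complex.exp_eq_exp_ℂ]
    exact exp_series_hasSum_exp' μ
  have hleft := hH.map (mulVec.addMonoidHomLeft w) (by
    change Continuous fun B : Matrix V V ℂ => B *ᵥ w
    fun_prop)
  refine hleft.unique ?_
  convert hμ.smul_const w using 2 with n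
  simp [mulVec.addMonoidHomLeft, smul_mulVec, hpow, smul_smul]

theorem exp_I_smul_mem_unitary {H : Matrix V V ℂ} (hH : H.IsHermitian) (t : ℝ) :
    exp ((Complex.I * (t : ℂ)) • H) ∈ unitary (Matrix V V ℂ) := by
  have hstar : star ((Complex.I * (t : ℂ)) • H) = -((Complex.I * (t : ℂ)) • H) := by
    rw [star_eq_conjTranspose, conjTranspose_smul, hH.eq]
    simp
  rw [Unitary.mem_iff, star_eq_conjTranspose, ← exp_conjTranspose, ← star_eq_conjTranspose, hstar]
  generalize (Complex.I * (t : ℂ)) • H = K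
  rw [← Matrix.exp_add_of_commute _ _ (Commute.refl K).neg_left,
    ← Matrix.exp_add_of_commute _ _ (Commute.refl K).neg_right]
  simp

/-- A row of a unitary matrix with an entry of modulus one vanishes at all other entries. -/
theorem eq_zero_of_mem_unitary_of_norm_eq_one {U : Matrix V V ℂ}
    (hU : U ∈ unitary (Matrix V V ℂ)) {j k l : V} (h : ‖U j k‖ ^ 2 = 1) (hl : l ≠ k) :
    U j l = 0 := by
  have hrow : ∑ i, ‖U j i‖ ^ 2 = 1 := by
    have hjj := congrFun (congrFun (Unitary.mem_iff.mp hU).2 j) j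
    rw [Matrix.mul_apply, one_apply_eq] at hjj
    have hcast : ((∑ i, ‖U j i‖ ^ 2 : ℝ) : ℂ) = 1 := by
      rw [← hjj]
      push_cast
      refine Finset.sum_congr rfl fun i _ => ?_
      rw [star_eq_conjTranspose, conjTranspose_apply]
      exact (Complex.mul_conj' _).symm
    exact_mod_cast hcast
  rw [← Finset.add_sum_erase _ _ (Finset.mem_univ k), h] at hrow
  have hzero := (Finset.sum_eq_zero_iff_of_nonneg fun i _ => sq_nonneg ‖U j i‖).mp
    (by linarith : ∑ i ∈ Finset.univ.erase k, ‖U j i‖ ^ 2 = 0) l (by simp [hl])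
  simpa using hzero

/-- Perfect state transfer from `j` determines the phases of all eigenvalues in the support
of `j`, up to sign. -/
theorem exp_two_mul_eq_sq_of_fidelity_eq_one {H : Matrix V V ℂ} (hH : H.IsHermitian)
    (hS : H.IsSymm) {j k : V} {t : ℝ} (h : fidelity H j k t = 1) {w : V → ℂ} {μ : ℂ}
    (hw : H *ᵥ w = μ • w) (hwj : w j ≠ 0) :
    Complex.exp (2 * (Complex.I * t * μ)) = exp ((Complex.I * (t : ℂ)) • H) j k ^ 2 := by
  have hU := exp_I_smul_mem_unitary hH t
  have hsymm : (exp ((Complex.I * (t : ℂ)) • H)).IsSymm := (hS.smul _).exp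
  have hUw : exp ((Complex.I * (t : ℂ)) • H) *ᵥ w = Complex.exp (Complex.I * t * μ) • w :=
    exp_mulVec_of_eigenvector (by rw [smul_mulVec, hw, smul_smul])
  unfold fidelity at h
  generalize exp ((Complex.I * (t : ℂ)) • H) = U at *
  have hrow : ∀ a b : V, ‖U a b‖ ^ 2 = 1 → (U *ᵥ w) a = U a b * w b := fun a b hab => by
    rw [mulVec, dotProduct, Finset.sum_eq_single b]
    · intro l _ hl
      rw [eq_zero_of_mem_unitary_of_norm_eq_one hU hab hl, zero_mul]
    · simp
  have hkj : U k j = U j k := hsymm.apply j k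
  have h₁ := hrow j k h
  have h₂ := hrow k j (by rw [hkj, h])
  rw [hUw, Pi.smul_apply, smul_eq_mul] at h₁ h₂
  rw [hkj] at h₂
  rw [two_mul, Complex.exp_add]
  apply mul_right_cancel₀ hwj
  -- The two relations exchange `w j` and `w k`; composing them eliminates `w k`.
  linear_combination Complex.exp (Complex.I * t * μ) * h₁ + U j k * h₂

theorem HasPST.symm {H : Matrix V V ℂ} (hS : H.IsSymm) {j k : V} (h : HasPST H j k) :
    HasPST H k j := by
  obtain ⟨hne, t, ht⟩ := h
  refine ⟨hne.symm, t, ?_⟩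
  unfold fidelity at *
  rwa [(hS.smul _).exp.apply j k]

theorem not_fidelity_zero_eq_one (H : Matrix V V ℂ) {j k : V} (h : j ≠ k) :
    fidelity H j k 0 ≠ 1 := by
  simp [fidelity, h]

/-- If `m` and `-m` with `m` a nonzero integer and an irrational number `x` all lie in the
eigenvalue support of `j`, there is no perfect state transfer from `j`. -/
theorem not_hasPST_of_irrational_eigenvalue {H : Matrix V V ℂ} (hH : H.IsHermitian)
    (hS : H.IsSymm) {j k : V} {m : ℤ} (hm : m ≠ 0) {x : ℝ} (hx : Irrational x)
    {w₁ w₂ w₃ : V → ℂ} (h₁ : H *ᵥ w₁ = (m : ℂ) • w₁) (h₂ : H *ᵥ w₂ = (-m : ℂ) • w₂)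
    (h₃ : H *ᵥ w₃ = (x : ℂ) • w₃) (h₁j : w₁ j ≠ 0) (h₂j : w₂ j ≠ 0) (h₃j : w₃ j ≠ 0) :
    ¬ HasPST H j k := by
  rintro ⟨hne, t, ht⟩
  have e₁ := exp_two_mul_eq_sq_of_fidelity_eq_one hH hS ht h₁ h₁j
  have e₂ := exp_two_mul_eq_sq_of_fidelity_eq_one hH hS ht h₂ h₂j
  have e₃ := exp_two_mul_eq_sq_of_fidelity_eq_one hH hS ht h₃ h₃j
  obtain ⟨p, hp⟩ := Complex.exp_eq_exp_iff_exists_int.mp (e₁.trans e₂.symm)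
  obtain ⟨q, hq⟩ := Complex.exp_eq_exp_iff_exists_int.mp (e₃.trans e₁.symm)
  have ht0 : t ≠ 0 := by
    rintro rfl
    exact not_fidelity_zero_eq_one H hne ht
  have hp' : 2 * t * m = p * Real.pi := by
    have : ((2 * t * m : ℝ) : ℂ) = ((p * Real.pi : ℝ) : ℂ) := by
      push_cast
      apply mul_left_cancel₀ (mul_ne_zero two_ne_zero Complex.I_ne_zero)
      linear_combination hp
    exact_mod_cast this
  have hq' : t * x = t * m + q * Real.pi := by
    have : ((t * x : ℝ) : ℂ) = ((t * m + q * Real.pi : ℝ) : ℂ) := by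
      push_cast
      apply mul_left_cancel₀ (mul_ne_zero two_ne_zero Complex.I_ne_zero)
      linear_combination hq
    exact_mod_cast this
  have hm' : (m : ℝ) ≠ 0 := by exact_mod_cast hm
  have hp0 : (p : ℝ) ≠ 0 := by
    intro h0
    rw [h0, zero_mul] at hp'
    exact mul_ne_zero (mul_ne_zero two_ne_zero ht0) hm' hp'
  apply hx
  -- Here `π / t = 2 * m / p` by `hp'`, and `x = m + q * π / t` by `hq'`.
  refine ⟨m + 2 * q * m / p, ?_⟩
  push_cast
  apply mul_left_cancel₀ ht0
  rw [hq']
  field_simp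
  linear_combination q * hp'

end General

/-! ### Integer form of the adjacency matrix, and its symmetry -/

theorem SimpleGraph.map_intCast_adjMatrix {V : Type*} (G : SimpleGraph V) [DecidableRel G.Adj] :
    (G.adjMatrix ℤ).map (Int.castRingHom ℂ) = G.adjMatrix ℂ := by
  ext i j
  simp [SimpleGraph.adjMatrix_apply, apply_ite]

/-- The adjacency matrix of the partially switched 5-cube with integer entries. -/
def intA53 : Matrix (Fin 32) (Fin 32) ℤ :=
  reindex finSumFinEquiv finSumFinEquiv
    (fromBlocks (Q4.adjMatrix ℤ) 1 1 (switchedQ4.adjMatrix ℤ))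

theorem map_intA53 : intA53.map (Int.castRingHom ℂ) = A53 := by
  rw [intA53, A53, A41, A42, reindex_apply, reindex_apply, ← submatrix_map, fromBlocks_map,
    SimpleGraph.map_intCast_adjMatrix, SimpleGraph.map_intCast_adjMatrix,
    Matrix.map_one _ (map_zero _) (map_one _)]

theorem isSymm_intA53 : intA53.IsSymm := by
  rw [intA53, reindex_apply]
  exact IsSymm.submatrix (IsSymm.fromBlocks (SimpleGraph.isSymm_adjMatrix (α := ℤ) Q4) transpose_one
    (SimpleGraph.isSymm_adjMatrix (α := ℤ) switchedQ4)) _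

theorem isSymm_A53 : A53.IsSymm := by
  rw [← map_intA53]
  exact isSymm_intA53.map _

theorem isHermitian_A53 : A53.IsHermitian := by
  ext i j
  rw [conjTranspose_apply, isSymm_A53.apply, ← map_intA53]
  simp

/-! ### An irrational eigenvalue seen off the corners -/

/-- The vertex of the 4-cube below a vertex of the 5-cube. -/
def baseVertex (v : Fin 32) : Fin 16 := Fin.ofNat 16 v

/-- The half of the 5-cube in which a vertex lies. -/
def half (v : Fin 32) : ℕ := v / 16

/-- The size of the subset of `{a, b, c, d}` that belongs to a vertex of the 5-cube. -/
def level (v : Fin 32) : ℕ :=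
  (Finset.univ.filter fun b => cubeLabel (baseVertex v) b = true).card

/-- The value at a vertex of the additive set function with weights `1, 2, 4, -7`; it vanishes
only at the empty and at the full set. -/
def setWeight (v : Fin 32) : ℤ :=
  ∑ b, if cubeLabel (baseVertex v) b = true then (![1, 2, 4, -7] : Fin 4 → ℤ) b else 0

/-- The set weights restricted to the levels `1, 2, 3` of the first half, then of the second. -/
def weightMatrix : Matrix (Fin 32) (Fin 6) ℤ :=
  of fun v i => if 3 * half v + level v = (i : ℕ) + 1 then setWeight v else 0

/-- The action of the adjacency matrix on the columns of `weightMatrix`. -/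
def weightAction : Matrix (Fin 6) (Fin 6) ℤ :=
  !![0, 2, 0, 1, 0, 0;
     1, 0, 1, 0, 1, 0;
     0, 2, 0, 0, 0, 1;
     1, 0, 0, 0, -2, 0;
     0, 1, 0, -1, 0, 1;
     0, 0, 1, 0, 2, 0]

/-- As the weights sum to zero, neighbour sums of an additive set function on one level are
multiples of that function. Switching joins singletons to the pairs not containing them, which turns
the factors `2, 1` between levels 1 and 2 into `-2, -1`. -/
theorem intA53_mul_weightMatrix : intA53 * weightMatrix = weightMatrix * weightAction := by
  decide +kernel

/-- An eigenvector of `weightAction` for each root `x` of its characteristic polynomial. -/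
def weightCoeff (x : ℝ) : Fin 6 → ℝ :=
  ![8 * x, (x ^ 2 - 1) ^ 2, 4 * x * (x ^ 2 - 3), 8 * x ^ 2 - 2 * (x ^ 2 - 1) ^ 2,
    x * (x ^ 2 - 1) * (x ^ 2 - 5), 2 * x ^ 4 - 8 * x ^ 2 - 2]

theorem weightAction_mulVec_weightCoeff {x : ℝ}
    (hx : x ^ 6 - 11 * x ^ 4 + 27 * x ^ 2 - 1 = 0) :
    weightAction.map (Int.castRingHom ℝ) *ᵥ weightCoeff x = x • weightCoeff x := by
  ext i
  fin_cases i <;>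
    simp [weightAction, weightCoeff, mulVec, dotProduct, Fin.sum_univ_succ] <;>
    -- Only coordinate `4` needs the equation for `x`; the other five are polynomial identities.
    first | ring1 | linear_combination -hx

theorem weightCoeff_ne_zero {x : ℝ} (h₀ : 0 < x) (h₁ : x < 1 / 4) (i : Fin 6) :
    weightCoeff x i ≠ 0 := by
  have hsq : x ^ 2 < 1 / 16 := by nlinarith
  have hne : x ≠ 0 := h₀.ne'
  have hsub : ∀ c : ℝ, 1 ≤ c → x ^ 2 - c ≠ 0 := fun c hc => by linarith
  fin_cases i
  · simpa [weightCoeff] using hne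
  · simpa [weightCoeff] using hsub 1 le_rfl
  · simpa [weightCoeff, hne] using hsub 3 (by norm_num)
  · have : 8 * x ^ 2 - 2 * (x ^ 2 - 1) ^ 2 < 0 := by nlinarith
    simpa [weightCoeff] using this.ne
  · simpa [weightCoeff, hne] using ⟨hsub 1 le_rfl, hsub 5 (by norm_num)⟩
  · have : 2 * x ^ 4 - 8 * x ^ 2 - 2 < 0 := by nlinarith [sq_nonneg x]
    simpa [weightCoeff] using this.ne

theorem exists_irrational_root :
    ∃ x : ℝ, 0 < x ∧ x < 1 / 4 ∧ x ^ 6 - 11 * x ^ 4 + 27 * x ^ 2 - 1 = 0 ∧ Irrational x := by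
  have hcont : ContinuousOn (fun x : ℝ => x ^ 6 - 11 * x ^ 4 + 27 * x ^ 2 - 1)
      (Set.Icc 0 (1 / 4)) := by fun_prop
  obtain ⟨x, ⟨h₀, h₁⟩, hx⟩ := intermediate_value_Ioo (by norm_num) hcont
    (show (0 : ℝ) ∈ Set.Ioo _ _ by constructor <;> norm_num)
  refine ⟨x, h₀, h₁, hx, ?_⟩
  rintro ⟨q, rfl⟩
  beta_reduce at hx
  have hq : q ^ 6 - 11 * q ^ 4 + 27 * q ^ 2 - 1 = 0 := by exact_mod_cast hx
  -- A rational root of a monic integer polynomial is an integer, and none lies in `(0, 1/4)`.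
  have hint : IsIntegral ℤ q := by
    refine ⟨Polynomial.X ^ 6 - 11 * Polynomial.X ^ 4 + 27 * Polynomial.X ^ 2 - 1, ?_, ?_⟩
    · monicity!
    · simpa using hq
  obtain ⟨n, rfl⟩ := IsIntegrallyClosed.isIntegral_iff.mp hint
  simp only [eq_intCast, Rat.cast_intCast] at h₀ h₁
  have hn₀ : 0 < n := by exact_mod_cast h₀
  have hn₁ : (n : ℝ) < 1 := by linarith
  have hn₁' : n < 1 := by exact_mod_cast hn₁
  omega

theorem A53_mulVec_weight {x : ℝ} (hx : x ^ 6 - 11 * x ^ 4 + 27 * x ^ 2 - 1 = 0) :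
    A53 *ᵥ (fun v => ((weightMatrix.map (Int.castRingHom ℝ) *ᵥ weightCoeff x) v : ℂ)) =
      (x : ℂ) • fun v => ((weightMatrix.map (Int.castRingHom ℝ) *ᵥ weightCoeff x) v : ℂ) := by
  have hreal : intA53.map (Int.castRingHom ℝ) *ᵥ
      (weightMatrix.map (Int.castRingHom ℝ) *ᵥ weightCoeff x) =
      x • (weightMatrix.map (Int.castRingHom ℝ) *ᵥ weightCoeff x) := by
    rw [mulVec_mulVec, ← Matrix.map_mul, intA53_mul_weightMatrix, Matrix.map_mul,
      ← mulVec_mulVec, weightAction_mulVec_weightCoeff hx, mulVec_smul]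
  rw [← map_intA53]
  ext v
  have := congrArg (fun r : ℝ => (r : ℂ)) (congrFun hreal v)
  simpa [mulVec, dotProduct] using this

theorem weight_ne_zero {x : ℝ} (h₀ : 0 < x) (h₁ : x < 1 / 4) {v : Fin 32}
    (hv : v ∉ ({0, 15, 16, 31} : Finset (Fin 32))) :
    (weightMatrix.map (Int.castRingHom ℝ) *ᵥ weightCoeff x) v ≠ 0 := by
  -- The index equation also holds for some `i` at the corners `15` and `16`, where only the
  -- vanishing of `setWeight` makes the entry zero.
  have key : ∀ v : Fin 32, v ∈ ({0, 15, 16, 31} : Finset (Fin 32)) ∨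
      ∃ i : Fin 6, 3 * half v + level v = (i : ℕ) + 1 ∧ setWeight v ≠ 0 := by decide +kernel
  obtain ⟨i, hi, hv₀⟩ := (key v).resolve_left hv
  rw [mulVec, dotProduct, Finset.sum_eq_single i]
  · exact mul_ne_zero (by simpa [weightMatrix, hi] using hv₀) (weightCoeff_ne_zero h₀ h₁ i)
  · intro l _ hli
    simp [weightMatrix, hi, Fin.val_inj, hli.symm]
  · simp

/-! ### Radial eigenvectors and transfer between corners -/

/-- The Krawtchouk matrix of the 5-cube; the entry in row `k` and column `d` is the value at
distance `d` of the zonal eigenvector with eigenvalue `5 - 2 k`. -/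
def krawtchouk : Matrix (Fin 6) (Fin 6) ℤ :=
  of fun k d => ∑ s ∈ Finset.range (k + 1),
    (-1) ^ s * ((d : ℕ).choose s : ℤ) * ((5 - (d : ℕ)).choose (k - s) : ℤ)

/-- The distance from the vertex `0`, or from the vertex `15`. -/
def cornerDist (c : Bool) (v : Fin 32) : Fin 6 :=
  Fin.ofNat 6 (half v + if c then 4 - level v else level v)

theorem intA53_mulVec_krawtchouk (c : Bool) (k : Fin 6) :
    intA53 *ᵥ (fun v => krawtchouk k (cornerDist c v)) =
      (5 - 2 * (k : ℤ)) • fun v => krawtchouk k (cornerDist c v) := by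
  have h : ∀ c k v, (intA53 *ᵥ (fun v => krawtchouk k (cornerDist c v))) v =
      (5 - 2 * ((k : ℕ) : ℤ)) * krawtchouk k (cornerDist c v) := by decide +kernel
  exact funext (h c k)

theorem A53_mulVec_krawtchouk (c : Bool) (k : Fin 6) :
    A53 *ᵥ (fun v => (krawtchouk k (cornerDist c v) : ℂ)) =
      (5 - 2 * (k : ℂ)) • fun v => (krawtchouk k (cornerDist c v) : ℂ) := by
  rw [← map_intA53]
  ext v
  have := congrArg (fun r : ℤ => (r : ℂ)) (congrFun (intA53_mulVec_krawtchouk c k) v)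
  simpa [mulVec, dotProduct] using this

theorem not_hasPST_A53 {j : Fin 32} (hj : j ∉ ({0, 15, 16, 31} : Finset (Fin 32)))
    (k : Fin 32) : ¬ HasPST A53 j k := by
  obtain ⟨x, h₀, h₁, hx, hirr⟩ := exists_irrational_root
  -- Row `0` is constantly `1` and row `5` is `(-1) ^ d`.
  have hne : ∀ v, krawtchouk 0 (cornerDist false v) ≠ 0 ∧
      krawtchouk 5 (cornerDist false v) ≠ 0 := by
    decide +kernel
  refine not_hasPST_of_irrational_eigenvalue isHermitian_A53 isSymm_A53 (m := 5) (by norm_num) hirr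
    (w₁ := fun v => (krawtchouk 0 (cornerDist false v) : ℂ))
    (w₂ := fun v => (krawtchouk 5 (cornerDist false v) : ℂ))
    ?_ ?_ (A53_mulVec_weight hx) ?_ ?_ ?_
  · rw [A53_mulVec_krawtchouk]
    norm_num
  · rw [A53_mulVec_krawtchouk]
    norm_num
  · exact_mod_cast (hne j).1
  · exact_mod_cast (hne j).2
  · exact_mod_cast weight_ne_zero h₀ h₁ hj

theorem exp_pi_div_two_mul (k : ℕ) :
    Complex.exp (Complex.I * ((Real.pi / 2 : ℝ) : ℂ) * (5 - 2 * k)) = Complex.I * (-1) ^ k := by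
  have : Complex.I * ((Real.pi / 2 : ℝ) : ℂ) * (5 - 2 * k) =
      Real.pi / 2 * Complex.I + 2 * Real.pi * Complex.I - k * (Real.pi * Complex.I) := by
    push_cast
    ring
  rw [this, Complex.exp_sub, Complex.exp_add, Complex.exp_pi_div_two_mul_I,
    Complex.exp_two_pi_mul_I, Complex.exp_nat_mul, Complex.exp_pi_mul_I, mul_one, div_eq_mul_inv,
    ← inv_pow]
  norm_num

/-- Perfect state transfer between the vertices at distance `5` from a corner and the corner. -/
theorem hasPST_A53_of_cornerDist (c : Bool) {j k : Fin 32}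
    (hj : ∀ v, cornerDist c v = 5 ↔ v = j) (hk : ∀ v, cornerDist c v = 0 ↔ v = k) :
    HasPST A53 j k := by
  -- Column `d` has generating function `(1 - z) ^ d * (1 + z) ^ (5 - d)`; `z = 1` and `z = -1` give
  -- the two sums. The phases `I * (-1) ^ k` at time `π / 2` turn the first into the second.
  have hsum : ∀ d : Fin 6, ∑ i, krawtchouk i d = if d = 0 then 32 else 0 := by decide +kernel
  have halt : ∀ d : Fin 6, ∑ i : Fin 6, (-1) ^ (i : ℕ) * krawtchouk i d =
      if d = 5 then 32 else 0 := by
    decide +kernel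
  set U := exp ((Complex.I * ((Real.pi / 2 : ℝ) : ℂ)) • A53) with hU
  have hUk : ∀ i : Fin 6, U *ᵥ (fun v => (krawtchouk i (cornerDist c v) : ℂ)) =
      (Complex.I * (-1) ^ (i : ℕ)) • fun v => (krawtchouk i (cornerDist c v) : ℂ) := fun i => by
    rw [← exp_pi_div_two_mul]
    exact exp_mulVec_of_eigenvector (by rw [smul_mulVec, A53_mulVec_krawtchouk, smul_smul])
  have hsingle : ∑ i : Fin 6, (fun v => (krawtchouk i (cornerDist c v) : ℂ)) =
      (32 : ℂ) • Pi.single k 1 := by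
    ext v
    have := congrArg (fun n : ℤ => (n : ℂ)) (hsum (cornerDist c v))
    simp only [hk] at this
    simpa [Finset.sum_apply, Pi.single_apply] using this
  have hentry : 32 * U j k = 32 * Complex.I := by
    have h := congrFun (congrArg (U *ᵥ ·) hsingle) j
    have halt' := congrArg (fun n : ℤ => (n : ℂ)) (halt (cornerDist c j))
    simp only [(hj j).mpr rfl, if_true] at halt'
    push_cast at halt'
    simp only [mulVec_sum, hUk, mulVec_smul, mulVec_single_one, Finset.sum_apply, Pi.smul_apply,
      smul_eq_mul, (hj j).mpr rfl, col_apply, mul_assoc, ← Finset.mul_sum, halt'] at h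
    rw [← h, mul_comm]
  refine ⟨?_, Real.pi / 2, ?_⟩
  · rintro rfl
    have h₁ := (hj j).mpr rfl
    rw [(hk j).mpr rfl] at h₁
    exact absurd h₁ (by decide)
  · rw [fidelity, ← hU, mul_left_cancel₀ (by norm_num) hentry]
    simp

theorem pstVertices_A53 : pstVertices A53 = ({0, 15, 16, 31} : Finset (Fin 32)) := by
  have h₀ : HasPST A53 31 0 :=
    hasPST_A53_of_cornerDist false (by decide +kernel) (by decide +kernel)
  have h₁ : HasPST A53 16 15 :=
    hasPST_A53_of_cornerDist true (by decide +kernel) (by decide +kernel)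
  ext j
  constructor
  · rintro ⟨k, hk⟩
    by_contra hj
    exact not_hasPST_A53 hj k hk
  · intro hj
    simp only [Finset.coe_insert, Finset.coe_singleton, Set.mem_insert_iff,
      Set.mem_singleton_iff] at hj
    rcases hj with rfl | rfl | rfl | rfl
    exacts [⟨_, h₀.symm isSymm_A53⟩, ⟨_, h₁.symm isSymm_A53⟩, ⟨_, h₁⟩, ⟨_, h₀⟩]

theorem mainTheorem4 :
    pstVertices A53 = {v : Fin 32 | (v : ℕ) + 1 ∈ ({1, 16, 17, 32} : Set ℕ)} ∧
      ((pstVertices A53).ncard : ℚ) / (Fintype.card (Fin 32) : ℚ) = 1 / 8 := by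
  rw [pstVertices_A53]
  constructor
  · ext v
    simp only [Finset.coe_insert, Finset.coe_singleton, Set.mem_insert_iff,
      Set.mem_singleton_iff, Set.mem_ofPred_eq, Fin.ext_iff]
    simp
  · rw [Set.ncard_coe_finset, Fintype.card_fin]
    have : ({0, 15, 16, 31} : Finset (Fin 32)).card = 4 := by decide
    rw [this]
    norm_num
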